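/- Let $T>0$, $\mu>0$, and let $0\le \mathcal T_1<\dots<\mathcal T_M\le T$ be the appointment times of $M\ge 0$ scheduled customers. A single server, with independent exponential service times of rate $\mu$, starts with an empty system at time $0$. Scheduled customers arrive at their appointment times. In addition there is a Poisson number, with mean $\lambda>0$, of walk-in customers, who choose their arrival times in $[0,T]$ independently according to a common probability distribution $F$. Service is first-come, first-served, with non-preemptive priority of scheduled over walk-in customers; walk-in customers arriving at the same time are placed in the queue in uniformly random order, behind a customer scheduled at that time. All customers who have arrived are served. Let $E_w(t)$ be the expected waiting time (before the start of service) of a walk-in customer who arrives at $t$ while the others (a Poisson($\lambda$) number) use $F$. A probability distribution $F_e$ on $[0,T]$ (possibly with atoms) is an equilibrium arrival distribution if there is a constant $E_w\ge 0$ such that, for $F=F_e$, $E_w(t)\ge E_w$ for all $t\in[0,T]$ and $E_w(t)=E_w$ for $F_e$-almost every $t$. Put $\mathcal T(1)=\mathcal T_1$ if $M\ge1$ and $\mathcal T(1)=T$ if $M=0$. Then: 1. For every $\lambda>0$, no equilibrium arrival distribution has an atom at any time $t\in(0,T]$. 2. If $\mathcal T(1)>0$, then for every $\lambda>0$ every equilibrium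 arrival distribution has an atom at $0$. 3. If $\mathcal T(1)=0$, there can be an atom at $0$: for the given $T$, $\mu$ and schedule there are a $\lambda>0$ and an equilibrium arrival distribution that has an atom at $0$. -/

import Mathlib

open MeasureTheory Set
open scoped ENNReal

noncomputable section

namespace WalkIn

/-- A schedule of `M` customers on `[0, T]`: strictly increasing appointment times.
`time i` (zero-based) is the appointment time of the customer number `i + 1`. -/
structure Schedule (T : ℝ) (M : ℕ) where
  time : Fin M → ℝ
  strictMono : StrictMono time
  mem_Icc : ∀ i, time i ∈ Icc 0 T

/-- The augmented schedule `𝒯(0) = 0`, `𝒯(k)` the `k`-th appointment time for `1 ≤ k ≤ M`, and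
`𝒯(M + 1) = T`. (The value `T` is also used for `k > M + 1`; these indices play no role.) -/
def Schedule.aug {T : ℝ} {M : ℕ} (S : Schedule T M) (k : ℕ) : ℝ :=
  if k = 0 then 0 else if h : k - 1 < M then S.time ⟨k - 1, h⟩ else T

/-- The appointment times strictly after `t`, in increasing order. -/
def Schedule.future {T : ℝ} {M : ℕ} (S : Schedule T M) (t : ℝ) : List ℝ :=
  (List.ofFn S.time).filter (fun τ => t < τ)

/-- The number (`0` or `1`) of customers scheduled exactly at time `t`. -/
def Schedule.countAt {T : ℝ} {M : ℕ} (S : Schedule T M) (t : ℝ) : ℕ :=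
  (Finset.univ.filter (fun i => S.time i = t)).card

/-- `Pois(x; i)`: the probability that `i` services with exponential times of rate `μ` are completed
during a period of length `x` in which the server is busy. -/
def pois (μ x : ℝ) (i : ℕ) : ℝ :=
  Real.exp (-(μ * x)) * (μ * x) ^ i / (i.factorial : ℝ)

/-- The density of the Erlang distribution with parameters `n ≥ 1` and `μ`. -/
def erlangDensity (n : ℕ) (μ x : ℝ) : ℝ :=
  μ ^ n * x ^ (n - 1) * Real.exp (-(μ * x)) / ((n - 1).factorial : ℝ)

/-- `wait μ L t n`: the expected waiting time of a walk-in customer who arrives at time `t` and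
finds `n` customers in front of her, when the appointment times still to come are those of the
(increasing) list `L`. If the next appointment is at `τ`, then either all `n` customers are served
before `τ`, or only `i < n` of them are, and the scheduled customer of time `τ` steps in front of
her. With `L = [𝒯(k+1), …, 𝒯(M)]` this is `w_{𝒯,k}(n, t)`. -/
def wait (μ : ℝ) : List ℝ → ℝ → ℕ → ℝ
  | [], _, n => n / μ
  | τ :: L, t, n =>
    if n = 0 then 0
    else (∫ x in (0 : ℝ)..(τ - t), x * erlangDensity n μ x) +
      ∑ i ∈ Finset.range n, pois μ (τ - t) i * ((τ - t) + wait μ L τ (n - i + 1))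

/-- `serve μ h n j`: the probability that of `n` customers present exactly `j` are left after a
period of length `h` without arrivals. -/
def serve (μ h : ℝ) (n j : ℕ) : ℝ :=
  if j = 0 then 1 - ∑ i ∈ Finset.range n, pois μ h i
  else if j ≤ n then pois μ h (n - j)
  else 0

/-- `trans μ t L r n j`: the probability of having `j` customers in the system just before time `t`,
given that there are `n` at time `r` and that single customers arrive in between exactly at the
times of the (nondecreasing) list `L`. -/
def trans (μ t : ℝ) : List ℝ → ℝ → ℕ → ℕ → ℝ
  | [], r, n, j => serve μ (t - r) n j
  | a :: L, r, n, j =>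
    ∑ i ∈ Finset.range (n + 1), serve μ (a - r) n i * trans μ t L a (i + 1) j

/-- All arrival times strictly before `t`, scheduled customers and walk-in customers together, in
nondecreasing order and with multiplicity, when the `m` walk-in customers arrive at times `x`. -/
def arrivalsBefore {T : ℝ} {M m : ℕ} (S : Schedule T M) (x : Fin m → ℝ) (t : ℝ) : List ℝ :=
  (((Finset.univ.val.map S.time) + (Finset.univ.val.map x)).filter (fun a => a < t)).sort (· ≤ ·)

/-- The number of walk-in customers who arrive exactly at time `t`. -/
def tiesAt {m : ℕ} (x : Fin m → ℝ) (t : ℝ) : ℕ :=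
  (Finset.univ.filter (fun i => x i = t)).card

/-- The expected waiting time of a tagged walk-in customer who arrives at time `t ∈ [0, T]`, given
that `m` other walk-in customers arrive at the times `x`; the system is empty just before time `0`.
If she finds `n` customers who arrived before `t` still in the system, she is behind these `n`,
behind the customer scheduled at `t` (if there is one), and behind `j` of the other walk-in
customers arriving at `t`, where `j` is uniform on `{0, …, tiesAt x t}`. -/
def condWait {T : ℝ} {M m : ℕ} (μ : ℝ) (S : Schedule T M) (x : Fin m → ℝ) (t : ℝ) : ℝ :=
  ∑ n ∈ Finset.range ((arrivalsBefore S x t).length + 1),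
    trans μ t (arrivalsBefore S x t) 0 0 n *
      ((∑ j ∈ Finset.range (tiesAt x t + 1), wait μ (S.future t) t (n + S.countAt t + j)) /
        ((tiesAt x t : ℝ) + 1))

/-- `E_w(t)`: the expected waiting time of a walk-in customer who arrives at time `t`, when the
number of other walk-in customers is Poisson distributed with mean `lam` and their arrival times
are independent with distribution `F`. -/
def expectedWait {T : ℝ} {M : ℕ} (μ lam : ℝ) (S : Schedule T M) (F : Measure ℝ) (t : ℝ) : ℝ≥0∞ :=
  ∑' m : ℕ, ENNReal.ofReal (Real.exp (-lam) * lam ^ m / (m.factorial : ℝ)) *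
    ∫⁻ x : Fin m → ℝ, ENNReal.ofReal (condWait μ S x t) ∂(Measure.pi fun _ => F)

/-- `F` is an equilibrium arrival distribution (arrivals restricted to `[0, T]`): it is a probability
distribution on `[0, T]`, and there is a value `c` such that, if all walk-in customers use `F`, the
expected waiting time is at least `c` at every admissible arrival time and equal to `c` at
`F`-almost every arrival time. -/
structure IsEquilibrium {T : ℝ} {M : ℕ} (μ lam : ℝ) (S : Schedule T M) (F : Measure ℝ) : Prop where
  isProbabilityMeasure : IsProbabilityMeasure F
  support : F (Icc 0 T)ᶜ = 0
  exists_value : ∃ c : NNReal,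
    (∀ t ∈ Icc 0 T, (c : ℝ≥0∞) ≤ expectedWait μ lam S F t) ∧
    (∀ᵐ t ∂F, expectedWait μ lam S F t = c)

/-- `F` has an atom at `t`: an arrival exactly at `t` has positive probability. -/
def HasAtom (F : Measure ℝ) (t : ℝ) : Prop := 0 < F {t}

end WalkIn

end

/-!
Write `wait μ L t n = n / μ + delay μ L t n`. The Erlang integral in `wait` is the mean `n / μ` less
a finite sum of Poisson terms (`integral_mul_erlangDensity`), so `delay` obeys a recursion with
nonnegative coefficients and no integral (`wait_eq`). It follows that `wait` is strictly increasing
in `n`, continuous in `t`, and lies between `n / μ` and `(n + L.length) / μ`.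

*No atoms after `0`.* A customer who arrives at an atom `t > 0` ties, with positive probability, with
another walk-in customer. Arriving at `s < t` and letting `s` increase to `t`, she is in front of all
who arrive at `t`; the customer scheduled at `t` can at worst overtake her, and is in front of her
anyway if she arrives at `t`. Hence `leftCondWait`, the limit of `condWait` for fixed arrival times
of the others, is at most `condWait`, strictly so in case of a tie. By dominated convergence
(`tendsto_expectedWait`) the expected waiting time just before `t` is smaller than at `t`
(`tsum_leftCondWait_lt`), whereas in equilibrium it is minimal at an atom. Dominated convergence
needs `condWait` to be measurable in the arrival times (`measurable_condWait`), which holds because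
it is given by a measurable expression for each order of the arrivals.

*An atom at `0`.* If nobody is scheduled at `0` and `0` is not an atom, then arriving at `0` costs
nothing, so the equilibrium value is `0`. But `F` then has no atoms at all and charges the past
of some `t` at which the value is attained (`exists_measure_Iio_ne_zero`), and the waiting time at
`t` is positive (`expectedWait_ne_zero`).

*Existence.* Let all walk-in customers arrive at `0`. Arriving at `0` as well puts a customer behind
`lam / 2` others on average; arriving at `t > 0` puts her behind all others, of whom at most `μ * T`
have been served on average (`le_sum_mul_trans`). For large `lam` the former is better, whatever the
schedule (`isEquilibrium_dirac_zero`).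
-/

noncomputable section

namespace WalkIn

open Filter Topology

/-! ### Poisson probabilities -/

lemma pois_zero_right (μ x : ℝ) : pois μ x 0 = Real.exp (-(μ * x)) := by simp [pois]

lemma pois_zero_arg (μ : ℝ) (i : ℕ) : pois μ 0 i = if i = 0 then 1 else 0 := by
  rcases i with _ | i <;> simp [pois]

lemma pois_nonneg {μ x : ℝ} (hμ : 0 ≤ μ) (hx : 0 ≤ x) (i : ℕ) : 0 ≤ pois μ x i := by
  unfold pois
  positivity

lemma continuous_pois (μ : ℝ) (i : ℕ) : Continuous fun x => pois μ x i := by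
  unfold pois
  fun_prop

lemma hasSum_pois (μ x : ℝ) : HasSum (pois μ x) 1 := by
  have h := (NormedSpace.expSeries_div_hasSum_exp (μ * x)).mul_left (Real.exp (-(μ * x)))
  rw [← Real.exp_eq_exp_ℝ, ← Real.exp_add, neg_add_cancel, Real.exp_zero] at h
  exact h.congr_fun fun i => by simp only [pois, mul_div_assoc]

/-- The Poisson distribution has mean `μ * x`. -/
lemma hasSum_mul_pois (μ x : ℝ) : HasSum (fun i : ℕ => (i : ℝ) * pois μ x i) (μ * x) := by
  rw [← hasSum_nat_add_iff' 1]
  have h := (hasSum_pois μ x).mul_left (μ * x)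
  simp only [Finset.sum_range_one, Nat.cast_zero, zero_mul, sub_zero]
  rw [mul_one] at h
  refine h.congr_fun fun i => ?_
  have : (i.factorial : ℝ) ≠ 0 := by positivity
  simp only [pois, Nat.factorial_succ]
  push_cast
  field_simp
  ring

lemma sum_pois_le_one {μ x : ℝ} (hμ : 0 ≤ μ) (hx : 0 ≤ x) (n : ℕ) :
    ∑ i ∈ Finset.range n, pois μ x i ≤ 1 :=
  sum_le_hasSum _ (fun i _ => pois_nonneg hμ hx i) (hasSum_pois μ x)

/-- On average at most `μ * x` of `n` customers are served during a period of length `x`. -/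
lemma le_sum_sub_mul_pois {μ x : ℝ} (hμ : 0 ≤ μ) (hx : 0 ≤ x) (n : ℕ) :
    n - μ * x ≤ ∑ i ∈ Finset.range n, ((n : ℝ) - i) * pois μ x i := by
  have h : HasSum (fun i : ℕ => ((i : ℝ) - n) * pois μ x i) (μ * x - n) := by
    simpa only [sub_mul, mul_one] using
      (hasSum_mul_pois μ x).sub ((hasSum_pois μ x).mul_left (n : ℝ))
  have h' := sum_le_hasSum (Finset.range n) (fun i hi => ?_) h
  · have : ∑ i ∈ Finset.range n, ((n : ℝ) - i) * pois μ x i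
        = -∑ i ∈ Finset.range n, ((i : ℝ) - n) * pois μ x i := by
      rw [← Finset.sum_neg_distrib]
      exact Finset.sum_congr rfl fun i _ => by ring
    linarith
  · have : (n : ℝ) ≤ i := by exact_mod_cast not_lt.1 (Finset.mem_range.not.1 hi)
    exact mul_nonneg (by linarith) (pois_nonneg hμ hx i)

lemma hasDerivAt_pois_zero (μ x : ℝ) : HasDerivAt (fun x => pois μ x 0) (-μ * pois μ x 0) x := by
  simp only [pois_zero_right]
  have h := (((hasDerivAt_id x).const_mul μ).neg).exp
  convert! h using 1
  simp
  ring

lemma hasDerivAt_pois_succ (μ x : ℝ) (i : ℕ) :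
    HasDerivAt (fun x => pois μ x (i + 1)) (μ * (pois μ x i - pois μ x (i + 1))) x := by
  have h := ((((hasDerivAt_id x).const_mul μ).neg).exp.mul
    (((hasDerivAt_id x).const_mul μ).pow (i + 1))).div_const ((i + 1).factorial : ℝ)
  convert! h using 1
  have : (i.factorial : ℝ) ≠ 0 := by positivity
  simp only [pois, Nat.factorial_succ, id, Pi.neg_apply, Pi.pow_apply, Nat.add_sub_cancel]
  push_cast
  field_simp
  ring

/-- Abel summation: the derivative of the sum telescopes to its last term. -/
lemma hasDerivAt_sum_pois_mul {μ : ℝ} (hμ : μ ≠ 0) (c x : ℝ) (k : ℕ) :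
    HasDerivAt (fun x => ∑ i ∈ Finset.range (k + 1), pois μ x i * (x + (c - i) / μ))
      (pois μ x k * (k + 1 - c - μ * x)) x := by
  induction k with
  | zero =>
    simp only [zero_add, Finset.sum_range_one, Nat.cast_zero, sub_zero]
    convert! (hasDerivAt_pois_zero μ x).mul ((hasDerivAt_id x).add_const (c / μ)) using 1
    simp only [id]
    field_simp
    ring
  | succ k ih =>
    simp only [Finset.sum_range_succ _ (k + 1)]
    convert! ih.add ((hasDerivAt_pois_succ μ x k).mul
      ((hasDerivAt_id x).add_const ((c - (k + 1 : ℕ)) / μ))) using 1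
    simp only [id]
    push_cast
    field_simp
    ring

/-! ### The expected waiting time given the queue length -/

/-- The mean of the Erlang distribution truncated at `h`. The `n`-th service ends after `n / μ` on
average; subtracted is the contribution of the cases in which only `i < n` services end before `h`,
where the remaining `n - i` services take `(n - i) / μ` more on average. -/
lemma integral_mul_erlangDensity {μ : ℝ} (hμ : μ ≠ 0) {n : ℕ} (hn : n ≠ 0) (h : ℝ) :
    ∫ x in (0 : ℝ)..h, x * erlangDensity n μ x =
      n / μ - ∑ i ∈ Finset.range n, pois μ h i * (h + ((n : ℝ) - i) / μ) := by
  obtain ⟨k, rfl⟩ := Nat.exists_eq_succ_of_ne_zero hn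
  have hd : ∀ x ∈ uIcc 0 h, HasDerivAt
      (fun x => -∑ i ∈ Finset.range (k + 1), pois μ x i * (x + (((k + 1 : ℕ) : ℝ) - i) / μ))
      (x * erlangDensity (k + 1) μ x) x := fun x _ => by
    convert! (hasDerivAt_sum_pois_mul hμ ((k + 1 : ℕ) : ℝ) x k).neg using 1
    have : (k.factorial : ℝ) ≠ 0 := by positivity
    simp only [erlangDensity, pois, Nat.add_sub_cancel]
    push_cast
    field_simp
    ring
  rw [intervalIntegral.integral_eq_sub_of_hasDerivAt hd]
  · simp [pois_zero_arg, Finset.sum_range_succ']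
    ring
  · refine Continuous.intervalIntegrable ?_ _ _
    unfold erlangDensity
    fun_prop

/-- The part of the expected waiting time that is due to scheduled customers who arrive later:
`wait μ L t n = n / μ + delay μ L t n`. -/
def delay (μ : ℝ) : List ℝ → ℝ → ℕ → ℝ
  | [], _, _ => 0
  | τ :: L, t, n => ∑ i ∈ Finset.range n, pois μ (τ - t) i * (delay μ L τ (n - i + 1) + 1 / μ)

lemma wait_eq {μ : ℝ} (hμ : μ ≠ 0) (L : List ℝ) (t : ℝ) (n : ℕ) :
    wait μ L t n = n / μ + delay μ L t n := by
  induction L generalizing t n with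
  | nil => simp [wait, delay]
  | cons τ L ih =>
    rw [wait, delay]
    split_ifs with hn
    · simp [hn]
    · rw [integral_mul_erlangDensity hμ hn, sub_add, ← Finset.sum_sub_distrib, sub_eq_add_neg,
        ← Finset.sum_neg_distrib]
      congr 1
      refine Finset.sum_congr rfl fun i hi => ?_
      rw [ih, Nat.cast_add, Nat.cast_sub (Finset.mem_range.1 hi).le]
      push_cast
      ring

lemma delay_nonneg {μ : ℝ} (hμ : 0 < μ) {L : List ℝ} {t : ℝ} (hL : (t :: L).Pairwise (· ≤ ·))
    (n : ℕ) : 0 ≤ delay μ L t n := by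
  induction L generalizing t n with
  | nil => simp [delay]
  | cons τ L ih =>
    rw [List.pairwise_cons] at hL
    refine Finset.sum_nonneg fun i _ => mul_nonneg (pois_nonneg hμ.le ?_ i) ?_
    · linarith [hL.1 τ (by simp)]
    · have := ih hL.2 (n - i + 1)
      positivity

lemma delay_le {μ : ℝ} (hμ : 0 < μ) {L : List ℝ} {t : ℝ} (hL : (t :: L).Pairwise (· ≤ ·))
    (n : ℕ) : delay μ L t n ≤ L.length / μ := by
  induction L generalizing t n with
  | nil => simp [delay]
  | cons τ L ih =>
    rw [List.pairwise_cons] at hL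
    have hτ : 0 ≤ τ - t := by linarith [hL.1 τ (by simp)]
    have h0 : (0 : ℝ) ≤ (L.length + 1 : ℝ) / μ := by positivity
    calc delay μ (τ :: L) t n
        ≤ ∑ i ∈ Finset.range n, pois μ (τ - t) i * ((L.length + 1) / μ) := by
          refine Finset.sum_le_sum fun i _ => mul_le_mul_of_nonneg_left ?_ (pois_nonneg hμ.le hτ i)
          rw [add_div]
          linarith [ih hL.2 (n - i + 1)]
      _ = (∑ i ∈ Finset.range n, pois μ (τ - t) i) * ((L.length + 1) / μ) := by
          rw [Finset.sum_mul]
      _ ≤ (τ :: L).length / μ := by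
          have := mul_le_mul_of_nonneg_right (sum_pois_le_one hμ.le hτ n) h0
          simpa using this

lemma delay_mono {μ : ℝ} (hμ : 0 < μ) {L : List ℝ} {t : ℝ} (hL : (t :: L).Pairwise (· ≤ ·)) :
    Monotone (delay μ L t) := by
  induction L generalizing t with
  | nil => exact fun _ _ _ => le_rfl
  | cons τ L ih =>
    rw [List.pairwise_cons] at hL
    have hτ : 0 ≤ τ - t := by linarith [hL.1 τ (by simp)]
    intro n m hnm
    calc delay μ (τ :: L) t n
        ≤ ∑ i ∈ Finset.range n, pois μ (τ - t) i * (delay μ L τ (m - i + 1) + 1 / μ) := by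
          refine Finset.sum_le_sum fun i _ => mul_le_mul_of_nonneg_left ?_ (pois_nonneg hμ.le hτ i)
          have := ih hL.2 (show n - i + 1 ≤ m - i + 1 by omega)
          linarith
      _ ≤ delay μ (τ :: L) t m := by
          refine Finset.sum_le_sum_of_subset_of_nonneg (by simpa using hnm) fun i _ _ =>
            mul_nonneg (pois_nonneg hμ.le hτ i) ?_
          have := delay_nonneg hμ hL.2 (m - i + 1)
          positivity

lemma continuous_delay (μ : ℝ) (L : List ℝ) (n : ℕ) : Continuous fun t => delay μ L t n := by
  cases L with
  | nil => simp only [delay]; fun_prop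
  | cons τ L =>
    simp only [delay]
    refine continuous_finsetSum _ fun i _ => Continuous.mul ?_ continuous_const
    exact (continuous_pois μ i).comp (by fun_prop)

lemma wait_zero {μ : ℝ} (L : List ℝ) (t : ℝ) : wait μ L t 0 = 0 := by
  cases L <;> simp [wait]

lemma div_le_wait {μ : ℝ} (hμ : 0 < μ) {L : List ℝ} {t : ℝ} (hL : (t :: L).Pairwise (· ≤ ·))
    (n : ℕ) : n / μ ≤ wait μ L t n := by
  rw [wait_eq hμ.ne']
  linarith [delay_nonneg hμ hL n]

lemma wait_nonneg {μ : ℝ} (hμ : 0 < μ) {L : List ℝ} {t : ℝ} (hL : (t :: L).Pairwise (· ≤ ·))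
    (n : ℕ) : 0 ≤ wait μ L t n :=
  le_trans (by positivity) (div_le_wait hμ hL n)

lemma wait_le {μ : ℝ} (hμ : 0 < μ) {L : List ℝ} {t : ℝ} (hL : (t :: L).Pairwise (· ≤ ·))
    (n : ℕ) : wait μ L t n ≤ (n + L.length) / μ := by
  rw [wait_eq hμ.ne', add_div]
  linarith [delay_le hμ hL n]

lemma wait_strictMono {μ : ℝ} (hμ : 0 < μ) {L : List ℝ} {t : ℝ}
    (hL : (t :: L).Pairwise (· ≤ ·)) : StrictMono (wait μ L t) := fun n m hnm => by
  rw [wait_eq hμ.ne', wait_eq hμ.ne']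
  have h1 := delay_mono hμ hL hnm.le
  have h2 : (n : ℝ) / μ < m / μ := by gcongr
  linarith

lemma continuous_wait {μ : ℝ} (hμ : μ ≠ 0) (L : List ℝ) (n : ℕ) :
    Continuous fun t => wait μ L t n := by
  simp only [wait_eq hμ]
  exact continuous_const.add (continuous_delay μ L n)

/-- A customer scheduled right now steps in front of a tagged customer who has somebody in front
of her. -/
lemma wait_cons_self {μ : ℝ} (hμ : μ ≠ 0) (L : List ℝ) (t : ℝ) {n : ℕ} (hn : n ≠ 0) :
    wait μ (t :: L) t n = wait μ L t (n + 1) := by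
  obtain ⟨k, rfl⟩ := Nat.exists_eq_succ_of_ne_zero hn
  rw [wait_eq hμ, wait_eq hμ]
  simp [delay, pois_zero_arg]
  ring

/-! ### The queue length process -/

lemma serve_nonneg {μ h : ℝ} (hμ : 0 ≤ μ) (hh : 0 ≤ h) (n j : ℕ) : 0 ≤ serve μ h n j := by
  unfold serve
  split_ifs
  · linarith [sum_pois_le_one hμ hh n]
  · exact pois_nonneg hμ hh _
  · exact le_rfl

lemma serve_self_pos (μ h : ℝ) (n : ℕ) : 0 < serve μ h n n := by
  unfold serve
  split_ifs with hn
  · simp [hn]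
  · rw [Nat.sub_self, pois_zero_right]
    positivity
  · exact absurd le_rfl ‹_›

lemma sum_mul_serve (μ h : ℝ) (f : ℕ → ℝ) {n N : ℕ} (hN : n < N) :
    ∑ j ∈ Finset.range N, f j * serve μ h n j =
      f 0 + ∑ i ∈ Finset.range n, (f (n - i) - f 0) * pois μ h i := by
  have h1 : ∑ j ∈ Finset.range N, f j * serve μ h n j
      = ∑ j ∈ Finset.range (n + 1), f j * serve μ h n j := by
    refine (Finset.sum_subset (by simpa using hN) fun j _ hj => ?_).symm
    have : n + 1 ≤ j := by simpa using hj
    rw [serve, if_neg (by omega), if_neg (by omega), mul_zero]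
  have h2 : ∑ j ∈ Finset.range n, f (j + 1) * serve μ h n (j + 1)
      = ∑ i ∈ Finset.range n, f (n - i) * pois μ h i := by
    rw [← Finset.sum_range_reflect]
    refine Finset.sum_congr rfl fun i hi => ?_
    have hi := Finset.mem_range.1 hi
    rw [serve, if_neg (by omega), if_pos (by omega), show n - 1 - i + 1 = n - i by omega,
      show n - (n - i) = i by omega]
  rw [h1, Finset.sum_range_succ', h2]
  simp only [serve, if_true, sub_mul, Finset.sum_sub_distrib, ← Finset.mul_sum]
  ring

lemma sum_serve (μ h : ℝ) {n N : ℕ} (hN : n < N) : ∑ j ∈ Finset.range N, serve μ h n j = 1 := by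
  simpa using sum_mul_serve μ h (fun _ => 1) hN

lemma le_sum_mul_serve {μ h : ℝ} (hμ : 0 ≤ μ) (hh : 0 ≤ h) {n N : ℕ} (hN : n < N) :
    n - μ * h ≤ ∑ j ∈ Finset.range N, (j : ℝ) * serve μ h n j := by
  rw [sum_mul_serve μ h _ hN]
  refine (le_sum_sub_mul_pois hμ hh n).trans_eq ?_
  rw [Nat.cast_zero, zero_add]
  refine Finset.sum_congr rfl fun i hi => ?_
  rw [Nat.cast_sub (Finset.mem_range.1 hi).le, sub_zero]

lemma continuous_serve (μ : ℝ) (n j : ℕ) : Continuous fun h => serve μ h n j := by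
  unfold serve
  split_ifs
  · exact continuous_const.sub (continuous_finsetSum _ fun i _ => continuous_pois μ i)
  · exact continuous_pois μ _
  · exact continuous_const

section Trans

variable {μ t : ℝ} {L : List ℝ} {r : ℝ}

lemma trans_nonneg (hμ : 0 ≤ μ) (hL : (r :: L).Pairwise (· ≤ ·)) (ht : ∀ a ∈ r :: L, a ≤ t)
    (n j : ℕ) : 0 ≤ trans μ t L r n j := by
  induction L generalizing r n with
  | nil => exact serve_nonneg hμ (by linarith [ht r (by simp)]) n j
  | cons a L ih =>
    rw [List.pairwise_cons] at hL
    refine Finset.sum_nonneg fun i _ => mul_nonneg (serve_nonneg hμ ?_ n i)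
      (ih hL.2 (fun b hb => ht b (List.mem_cons_of_mem r hb)) (i + 1))
    linarith [hL.1 a (by simp)]

lemma sum_trans (μ t : ℝ) (L : List ℝ) (r : ℝ) {n N : ℕ} (hN : n + L.length < N) :
    ∑ j ∈ Finset.range N, trans μ t L r n j = 1 := by
  induction L generalizing r n with
  | nil => exact sum_serve μ _ hN
  | cons a L ih =>
    simp only [trans]
    rw [Finset.sum_comm, ← sum_serve μ (a - r) (Nat.lt_succ_self n)]
    refine Finset.sum_congr rfl fun i hi => ?_
    rw [← Finset.mul_sum, ih, mul_one]
    simp only [List.length_cons, Finset.mem_range] at hN hi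
    omega

/-- Since services are completed at rate at most `μ`, the expected number of customers present at
time `t` is at least the number of arrivals minus `μ` times the elapsed time. -/
lemma le_sum_mul_trans (hμ : 0 ≤ μ) (hL : (r :: L).Pairwise (· ≤ ·)) (ht : ∀ a ∈ r :: L, a ≤ t)
    {n N : ℕ} (hN : n + L.length < N) :
    n + L.length - μ * (t - r) ≤ ∑ j ∈ Finset.range N, (j : ℝ) * trans μ t L r n j := by
  induction L generalizing r n with
  | nil =>
    have h := le_sum_mul_serve hμ (by linarith [ht r (by simp)] : 0 ≤ t - r) hN
    rwa [List.length_nil, Nat.cast_zero, add_zero]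
  | cons a L ih =>
    rw [List.pairwise_cons] at hL
    have har : 0 ≤ a - r := by linarith [hL.1 a (by simp)]
    simp only [trans, Finset.mul_sum]
    rw [Finset.sum_comm]
    have h0 := sum_serve μ (a - r) (Nat.lt_succ_self n)
    have h1 := le_sum_mul_serve hμ har (Nat.lt_succ_self n)
    calc (n : ℝ) + (a :: L).length - μ * (t - r)
        ≤ (∑ i ∈ Finset.range (n + 1), (i : ℝ) * serve μ (a - r) n i) +
            (1 + L.length - μ * (t - a)) * ∑ i ∈ Finset.range (n + 1), serve μ (a - r) n i := by
          rw [h0, List.length_cons]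
          push_cast
          linarith
      _ = ∑ i ∈ Finset.range (n + 1),
            serve μ (a - r) n i * (((i + 1 : ℕ) : ℝ) + L.length - μ * (t - a)) := by
          rw [Finset.mul_sum, ← Finset.sum_add_distrib]
          refine Finset.sum_congr rfl fun i _ => ?_
          push_cast
          ring
      _ ≤ _ := by
          refine Finset.sum_le_sum fun i hi => ?_
          simp only [mul_left_comm _ (serve μ (a - r) n i), ← Finset.mul_sum]
          refine mul_le_mul_of_nonneg_left (ih hL.2 (fun b hb => ht b (List.mem_cons_of_mem r hb))
            ?_) (serve_nonneg hμ har n i)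
          simp only [List.length_cons, Finset.mem_range] at hN hi
          omega

/-- With positive probability nobody is served before `t`. -/
lemma trans_pos (hμ : 0 ≤ μ) (hL : (r :: L).Pairwise (· ≤ ·)) (ht : ∀ a ∈ r :: L, a ≤ t)
    (n : ℕ) : 0 < trans μ t L r n (n + L.length) := by
  induction L generalizing r n with
  | nil => exact serve_self_pos μ _ n
  | cons a L ih =>
    rw [List.pairwise_cons] at hL
    have ht' : ∀ b ∈ a :: L, b ≤ t := fun b hb => ht b (List.mem_cons_of_mem r hb)
    rw [trans]
    refine Finset.sum_pos' (fun i _ => mul_nonneg (serve_nonneg hμ ?_ n i)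
      (trans_nonneg hμ hL.2 ht' _ _)) ⟨n, by simp, mul_pos (serve_self_pos μ _ n) ?_⟩
    · linarith [hL.1 a (by simp)]
    · rw [List.length_cons, show n + (L.length + 1) = n + 1 + L.length by omega]
      exact ih hL.2 ht' (n + 1)

lemma continuous_trans (μ : ℝ) (L : List ℝ) (r : ℝ) (n j : ℕ) :
    Continuous fun t => trans μ t L r n j := by
  induction L generalizing r n with
  | nil => exact (continuous_serve μ n j).comp (by fun_prop)
  | cons a L ih => exact continuous_finsetSum _ fun i _ => continuous_const.mul (ih a (i + 1))

lemma measurable_trans {α ι : Type*} [MeasurableSpace α] (μ t : ℝ) {f : ι → α → ℝ}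
    (hf : ∀ i, Measurable (f i)) (l : List ι) {ρ : α → ℝ} (hρ : Measurable ρ) (n j : ℕ) :
    Measurable fun x => trans μ t (l.map fun i => f i x) (ρ x) n j := by
  induction l generalizing ρ n with
  | nil => exact (continuous_serve μ n j).measurable.comp (measurable_const.sub hρ)
  | cons a l ih =>
    simp only [List.map_cons, trans]
    exact Finset.measurable_fun_sum _ fun i _ =>
      ((continuous_serve μ n i).measurable.comp ((hf a).sub hρ)).mul (ih (hf a) (i + 1))

end Trans

/-! ### The schedule seen from a given time -/

lemma filter_le_of_pairwise_lt {l : List ℝ} (hl : l.Pairwise (· < ·)) (t : ℝ) :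
    l.filter (fun τ => t ≤ τ) =
      if t ∈ l then t :: l.filter (fun τ => t < τ) else l.filter (fun τ => t < τ) := by
  induction l with
  | nil => simp
  | cons a l ih =>
    rw [List.pairwise_cons] at hl
    have ih := ih hl.2
    rcases lt_trichotomy a t with h | rfl | h
    · simpa [h.not_ge, h.not_gt, h.ne'] using ih
    · have ha : a ∉ l := fun h => lt_irrefl _ (hl.1 a h)
      simpa [ha] using ih
    · have ht : t ∉ l := fun h' => lt_asymm h (hl.1 t h')
      rw [if_neg ht] at ih
      simpa [h.le, h, h.ne, ht] using ih

section Schedule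

variable {T : ℝ} {M m : ℕ} (S : Schedule T M)

/-- The appointment times from `t` on, time `t` included, in increasing order. -/
def Schedule.futureFrom (t : ℝ) : List ℝ :=
  (List.ofFn S.time).filter (fun τ => t ≤ τ)

lemma Schedule.pairwise_ofFn : (List.ofFn S.time).Pairwise (· < ·) :=
  List.pairwise_ofFn.2 fun _ _ h => S.strictMono h

lemma Schedule.pairwise_future (t : ℝ) : (t :: S.future t).Pairwise (· ≤ ·) := by
  refine List.pairwise_cons.2 ⟨fun τ hτ => ?_, (S.pairwise_ofFn.filter _).imp le_of_lt⟩
  exact (by simpa using (List.mem_filter.1 hτ).2 : t < τ).le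

lemma Schedule.pairwise_futureFrom (t : ℝ) : (t :: S.futureFrom t).Pairwise (· ≤ ·) := by
  refine List.pairwise_cons.2 ⟨fun τ hτ => ?_, (S.pairwise_ofFn.filter _).imp le_of_lt⟩
  simpa using (List.mem_filter.1 hτ).2

lemma Schedule.length_future_le (t : ℝ) : (S.future t).length ≤ M :=
  (List.length_filter_le _ _).trans_eq (by simp)

lemma Schedule.countAt_le (t : ℝ) : S.countAt t ≤ M :=
  (Finset.card_filter_le _ _).trans_eq (by simp)

lemma Schedule.countAt_eq (t : ℝ) : S.countAt t = if t ∈ List.ofFn S.time then 1 else 0 := by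
  unfold Schedule.countAt
  split_ifs with h
  · obtain ⟨i, hi⟩ := (List.mem_ofFn' _ _).1 h
    refine Finset.card_eq_one.2 ⟨i, Finset.ext fun k => ?_⟩
    simp only [Finset.mem_filter, Finset.mem_univ, true_and, Finset.mem_singleton]
    exact ⟨fun hk => S.strictMono.injective (hk.trans hi.symm), fun hk => hk ▸ hi⟩
  · refine Finset.card_eq_zero.2 (Finset.filter_eq_empty_iff.2 fun i _ hi => h ?_)
    exact (List.mem_ofFn' _ _).2 ⟨i, hi⟩

/-- Arriving just before `t` a customer may be overtaken by the customer scheduled at `t`, arriving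
at `t` she is certainly behind that customer. -/
lemma wait_futureFrom_le {μ : ℝ} (hμ : 0 < μ) (t : ℝ) (n : ℕ) :
    wait μ (S.futureFrom t) t n ≤ wait μ (S.future t) t (n + S.countAt t) := by
  have h0 := S.pairwise_future t
  rw [Schedule.futureFrom, filter_le_of_pairwise_lt S.pairwise_ofFn, S.countAt_eq]
  split_ifs
  · rcases eq_or_ne n 0 with rfl | hn
    · rw [wait_zero]
      exact wait_nonneg hμ h0 _
    · exact (wait_cons_self hμ.ne' _ t hn).le
  · exact le_rfl

/-! ### Waiting times for given arrival times -/

variable {μ t : ℝ} {x : Fin m → ℝ}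

lemma mem_arrivalsBefore {a : ℝ} :
    a ∈ arrivalsBefore S x t ↔ ((∃ i, S.time i = a) ∨ ∃ i, x i = a) ∧ a < t := by
  simp [arrivalsBefore, or_and_right]

lemma arrivalsBefore_le (ht : 0 ≤ t) : ∀ a ∈ (0 : ℝ) :: arrivalsBefore S x t, a ≤ t := by
  intro a ha
  rcases List.mem_cons.1 ha with rfl | ha
  · exact ht
  · exact ((mem_arrivalsBefore S).1 ha).2.le

lemma pairwise_arrivalsBefore (hx : ∀ i, 0 ≤ x i) :
    ((0 : ℝ) :: arrivalsBefore S x t).Pairwise (· ≤ ·) := by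
  refine List.pairwise_cons.2 ⟨fun a ha => ?_, Multiset.pairwise_sort _ _⟩
  rcases ((mem_arrivalsBefore S).1 ha).1 with ⟨i, rfl⟩ | ⟨i, rfl⟩
  · exact (S.mem_Icc i).1
  · exact hx i

lemma length_arrivalsBefore_le : (arrivalsBefore S x t).length ≤ M + m := by
  rw [arrivalsBefore, Multiset.length_sort]
  exact (Multiset.card_le_card (Multiset.filter_le _ _)).trans_eq (by simp)

lemma le_length_arrivalsBefore (hx : ∀ i, x i < t) : m ≤ (arrivalsBefore S x t).length := by
  have h : (Finset.univ.val.map x).filter (· < t) = Finset.univ.val.map x :=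
    Multiset.filter_eq_self.2 (by simpa using hx)
  rw [arrivalsBefore, Multiset.length_sort, Multiset.filter_add, Multiset.card_add, h]
  simp

lemma tiesAt_le : tiesAt x t ≤ m :=
  (Finset.card_filter_le _ _).trans_eq (by simp)

/-- The expected waiting time of a tagged customer with `n + S.countAt t` customers certainly in
front of her and `k` others arriving at the same time `t`. -/
def tieWait (μ : ℝ) (S : Schedule T M) (t : ℝ) (k n : ℕ) : ℝ :=
  (∑ j ∈ Finset.range (k + 1), wait μ (S.future t) t (n + S.countAt t + j)) / ((k : ℝ) + 1)

lemma tieWait_zero (μ t : ℝ) (n : ℕ) :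
    tieWait μ S t 0 n = wait μ (S.future t) t (n + S.countAt t) := by
  simp [tieWait]

lemma condWait_eq : condWait μ S x t = ∑ n ∈ Finset.range ((arrivalsBefore S x t).length + 1),
    trans μ t (arrivalsBefore S x t) 0 0 n * tieWait μ S t (tiesAt x t) n := rfl

lemma wait_le_tieWait (hμ : 0 < μ) (t : ℝ) (k n : ℕ) :
    wait μ (S.future t) t (n + S.countAt t) ≤ tieWait μ S t k n := by
  rw [tieWait, le_div_iff₀ (by positivity)]
  refine le_trans (le_of_eq ?_) (Finset.card_nsmul_le_sum _ _
    (wait μ (S.future t) t (n + S.countAt t)) fun j _ =>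
      (wait_strictMono hμ (S.pairwise_future t)).monotone (Nat.le_add_right _ j))
  simp
  ring

lemma wait_lt_tieWait (hμ : 0 < μ) (t : ℝ) {k : ℕ} (hk : k ≠ 0) (n : ℕ) :
    wait μ (S.future t) t (n + S.countAt t) < tieWait μ S t k n := by
  have h := wait_strictMono hμ (S.pairwise_future t)
  rw [tieWait, lt_div_iff₀ (by positivity)]
  refine lt_of_eq_of_lt ?_ (Finset.sum_lt_sum (s := Finset.range (k + 1))
    (f := fun _ => wait μ (S.future t) t (n + S.countAt t))
    (fun j _ => h.monotone (Nat.le_add_right _ j))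
    ⟨k, by simp, h (by omega : n + S.countAt t < n + S.countAt t + k)⟩)
  simp
  ring

lemma div_le_tieWait (hμ : 0 < μ) (t : ℝ) (k n : ℕ) : n / μ ≤ tieWait μ S t k n := by
  refine le_trans ?_ ((div_le_wait hμ (S.pairwise_future t) _).trans (wait_le_tieWait S hμ t k n))
  gcongr
  omega

lemma tieWait_nonneg (hμ : 0 < μ) (t : ℝ) (k n : ℕ) : 0 ≤ tieWait μ S t k n :=
  le_trans (by positivity) (div_le_tieWait S hμ t k n)

/-- The average number of customers in front among `k` simultaneous arrivals is `k / 2`. -/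
lemma tieWait_le (hμ : 0 < μ) (t : ℝ) (k n : ℕ) :
    tieWait μ S t k n ≤ (n + 2 * M + k / 2) / μ := by
  have hS : (S.countAt t : ℝ) ≤ M := by exact_mod_cast S.countAt_le t
  have hF : ((S.future t).length : ℝ) ≤ M := by exact_mod_cast S.length_future_le t
  have hk : ∑ j ∈ Finset.range (k + 1), (j : ℝ) = (k + 1) * (k / 2) := by
    rw [← Nat.cast_sum, Finset.sum_range_id, ← mul_div_assoc, ← Nat.cast_succ, ← Nat.cast_mul,
      Nat.add_sub_cancel, Nat.cast_div_charZero]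
    · simp
    · simpa [mul_comm] using (Nat.even_mul_succ_self k).two_dvd
  rw [tieWait, div_le_iff₀ (by positivity)]
  calc ∑ j ∈ Finset.range (k + 1), wait μ (S.future t) t (n + S.countAt t + j)
      ≤ ∑ j ∈ Finset.range (k + 1), (((n : ℝ) + 2 * M) / μ + j / μ) := by
        refine Finset.sum_le_sum fun j _ => (wait_le hμ (S.pairwise_future t) _).trans ?_
        rw [← add_div]
        refine div_le_div_of_nonneg_right ?_ hμ.le
        push_cast
        linarith
    _ = (n + 2 * M + k / 2) / μ * (k + 1) := by
        rw [Finset.sum_add_distrib, ← Finset.sum_div _ fun j : ℕ => (j : ℝ), hk]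
        simp
        ring

lemma condWait_nonneg (hμ : 0 < μ) (ht : 0 ≤ t) (hx : ∀ i, 0 ≤ x i) : 0 ≤ condWait μ S x t :=
  Finset.sum_nonneg fun n _ => mul_nonneg
    (trans_nonneg hμ.le (pairwise_arrivalsBefore S hx) (arrivalsBefore_le S ht) 0 n)
    (tieWait_nonneg S hμ t _ n)

lemma condWait_le (hμ : 0 < μ) (ht : 0 ≤ t) (hx : ∀ i, 0 ≤ x i) :
    condWait μ S x t ≤ ((arrivalsBefore S x t).length + 2 * M + tiesAt x t / 2) / μ := by
  have h1 := sum_trans μ t (arrivalsBefore S x t) 0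
    (show 0 + (arrivalsBefore S x t).length < (arrivalsBefore S x t).length + 1 by omega)
  rw [condWait_eq, ← one_mul (_ / μ), ← h1, Finset.sum_mul]
  refine Finset.sum_le_sum fun n hn => mul_le_mul_of_nonneg_left ((tieWait_le S hμ t _ n).trans ?_)
    (trans_nonneg hμ.le (pairwise_arrivalsBefore S hx) (arrivalsBefore_le S ht) 0 n)
  have hn : (n : ℝ) ≤ (arrivalsBefore S x t).length := by
    exact_mod_cast Nat.lt_succ_iff.1 (Finset.mem_range.1 hn)
  gcongr

lemma condWait_le' (hμ : 0 < μ) (ht : 0 ≤ t) (hx : ∀ i, 0 ≤ x i) :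
    condWait μ S x t ≤ (3 * M + 2 * m) / μ := by
  refine (condWait_le S hμ ht hx).trans ?_
  have h1 : ((arrivalsBefore S x t).length : ℝ) ≤ M + m := by
    exact_mod_cast length_arrivalsBefore_le S
  have h2 : (tiesAt x t : ℝ) ≤ m := by exact_mod_cast tiesAt_le
  refine div_le_div_of_nonneg_right ?_ hμ.le
  linarith [(Nat.cast_nonneg m : (0 : ℝ) ≤ m)]

/-- The tagged customer waits at least for the expected work brought by those who arrived before
her, less the time elapsed, which bounds the work done. -/
lemma le_condWait (hμ : 0 < μ) (ht : 0 ≤ t) (hx : ∀ i, 0 ≤ x i) :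
    (arrivalsBefore S x t).length / μ - t ≤ condWait μ S x t := by
  have hs := pairwise_arrivalsBefore S (t := t) hx
  have hl := arrivalsBefore_le S (x := x) ht
  have h1 := le_sum_mul_trans hμ.le hs hl
    (show 0 + (arrivalsBefore S x t).length < (arrivalsBefore S x t).length + 1 by omega)
  calc ((arrivalsBefore S x t).length : ℝ) / μ - t
      = ((0 : ℕ) + (arrivalsBefore S x t).length - μ * (t - 0)) / μ := by
        field_simp
        simp
    _ ≤ _ := div_le_div_of_nonneg_right h1 hμ.le
    _ ≤ condWait μ S x t := by
        rw [condWait_eq, Finset.sum_div]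
        refine Finset.sum_le_sum fun n _ => ?_
        rw [mul_comm, mul_div_assoc]
        exact mul_le_mul_of_nonneg_left (div_le_tieWait S hμ t _ n) (trans_nonneg hμ.le hs hl 0 n)

/-- With positive probability no service is completed before the tagged customer arrives. -/
lemma condWait_pos (hμ : 0 < μ) (ht : 0 ≤ t) (hx : ∀ i, 0 ≤ x i)
    (h : arrivalsBefore S x t ≠ []) : 0 < condWait μ S x t := by
  have hs := pairwise_arrivalsBefore S (t := t) hx
  have hl := arrivalsBefore_le S (x := x) ht
  refine Finset.sum_pos' (fun n _ => mul_nonneg (trans_nonneg hμ.le hs hl 0 n)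
    (tieWait_nonneg S hμ t _ n)) ⟨(arrivalsBefore S x t).length, by simp, mul_pos ?_ ?_⟩
  · simpa using trans_pos hμ.le hs hl 0
  · refine lt_of_lt_of_le ?_ (div_le_tieWait S hμ t _ _)
    have := List.length_pos_iff.2 h
    positivity

lemma condWait_of_arrivalsBefore_eq_nil (h : arrivalsBefore S x 0 = []) :
    condWait μ S x 0 = tieWait μ S 0 (tiesAt x 0) 0 := by
  simp [condWait_eq, h, trans, serve]

/-! ### Arriving just before a given time -/

/-- The limit of `condWait μ S x s` as `s` increases to `t`: the tagged customer is in front of all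
customers who arrive at `t`, but the customer scheduled at `t` may overtake her. -/
def leftCondWait (μ : ℝ) (S : Schedule T M) (x : Fin m → ℝ) (t : ℝ) : ℝ :=
  ∑ n ∈ Finset.range ((arrivalsBefore S x t).length + 1),
    trans μ t (arrivalsBefore S x t) 0 0 n * wait μ (S.futureFrom t) t n

lemma leftCondWait_le (hμ : 0 < μ) (ht : 0 ≤ t) (hx : ∀ i, 0 ≤ x i) :
    leftCondWait μ S x t ≤ condWait μ S x t :=
  Finset.sum_le_sum fun n _ => mul_le_mul_of_nonneg_left
    ((wait_futureFrom_le S hμ t n).trans (wait_le_tieWait S hμ t _ n))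
    (trans_nonneg hμ.le (pairwise_arrivalsBefore S hx) (arrivalsBefore_le S ht) 0 n)

lemma leftCondWait_nonneg (hμ : 0 < μ) (ht : 0 ≤ t) (hx : ∀ i, 0 ≤ x i) :
    0 ≤ leftCondWait μ S x t :=
  Finset.sum_nonneg fun n _ => mul_nonneg
    (trans_nonneg hμ.le (pairwise_arrivalsBefore S hx) (arrivalsBefore_le S ht) 0 n)
    (wait_nonneg hμ (S.pairwise_futureFrom t) n)

/-- A tie at `t` makes arriving at `t` strictly worse than arriving just before. -/
lemma leftCondWait_lt (hμ : 0 < μ) (ht : 0 ≤ t) (hx : ∀ i, 0 ≤ x i) (h : tiesAt x t ≠ 0) :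
    leftCondWait μ S x t < condWait μ S x t := by
  have hs := pairwise_arrivalsBefore S (t := t) hx
  have hl := arrivalsBefore_le S (x := x) ht
  refine Finset.sum_lt_sum (fun n _ => mul_le_mul_of_nonneg_left
    ((wait_futureFrom_le S hμ t n).trans (wait_le_tieWait S hμ t _ n))
    (trans_nonneg hμ.le hs hl 0 n)) ⟨(arrivalsBefore S x t).length, by simp, ?_⟩
  refine mul_lt_mul_of_pos_left
    ((wait_futureFrom_le S hμ t _).trans_lt (wait_lt_tieWait S hμ t h _)) ?_
  simpa using trans_pos hμ.le hs hl 0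

lemma eventually_lt_iff_lt_left (a t : ℝ) : ∀ᶠ s in 𝓝[<] t, (a < s ↔ a < t) := by
  by_cases h : a < t
  · filter_upwards [Ioo_mem_nhdsLT h] with s hs
    simp [h, hs.1]
  · filter_upwards [self_mem_nhdsWithin] with s hs
    simp only [h, iff_false, not_lt] at hs ⊢
    exact hs.le.trans (not_lt.1 h)

lemma tendsto_condWait (hμ : 0 < μ) (x : Fin m → ℝ) (t : ℝ) :
    Tendsto (fun s => condWait μ S x s) (𝓝[<] t) (𝓝 (leftCondWait μ S x t)) := by
  have hS : ∀ᶠ s in 𝓝[<] t, ∀ i, (S.time i < s ↔ S.time i < t) :=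
    eventually_all.2 fun i => eventually_lt_iff_lt_left _ t
  have hX : ∀ᶠ s in 𝓝[<] t, ∀ i, (x i < s ↔ x i < t) :=
    eventually_all.2 fun i => eventually_lt_iff_lt_left _ t
  have heq : ∀ᶠ s in 𝓝[<] t, ∑ n ∈ Finset.range ((arrivalsBefore S x t).length + 1),
      trans μ s (arrivalsBefore S x t) 0 0 n * wait μ (S.futureFrom t) s n = condWait μ S x s := by
    filter_upwards [hS, hX, self_mem_nhdsWithin] with s hS hX (hs : s < t)
    have harr : arrivalsBefore S x s = arrivalsBefore S x t := by
      unfold arrivalsBefore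
      congr 1
      refine Multiset.filter_congr fun a ha => ?_
      rcases Multiset.mem_add.1 ha with ha | ha <;> obtain ⟨i, -, rfl⟩ := Multiset.mem_map.1 ha
      exacts [hS i, hX i]
    have hcount : S.countAt s = 0 :=
      Finset.card_eq_zero.2 (Finset.filter_eq_empty_iff.2 fun i _ hi =>
        lt_irrefl s (by simpa [hi, hs] using hS i))
    have hties : tiesAt x s = 0 :=
      Finset.card_eq_zero.2 (Finset.filter_eq_empty_iff.2 fun i _ hi =>
        lt_irrefl s (by simpa [hi, hs] using hX i))
    have hfut : S.future s = S.futureFrom t := by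
      refine List.filter_congr fun τ hτ => ?_
      obtain ⟨i, rfl⟩ := (List.mem_ofFn' _ _).1 hτ
      refine decide_eq_decide.2 ⟨fun h => ?_, hs.trans_le⟩
      exact not_lt.1 fun h' => lt_asymm h ((hS i).2 h')
    rw [condWait_eq, harr, hties, ← hfut]
    simp only [tieWait_zero, hcount, add_zero]
  refine Tendsto.congr' heq ?_
  have hc : Continuous fun s => ∑ n ∈ Finset.range ((arrivalsBefore S x t).length + 1),
      trans μ s (arrivalsBefore S x t) 0 0 n * wait μ (S.futureFrom t) s n :=
    continuous_finsetSum _ fun n _ =>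
      (continuous_trans μ _ 0 0 n).mul (continuous_wait hμ.ne' _ n)
  exact (hc.tendsto t).mono_left nhdsWithin_le_nhds

end Schedule

/-! ### Measurability in the arrival times -/

section Measurability

variable {T : ℝ} {M m : ℕ} (S : Schedule T M)

/-- The arrival times of all customers, scheduled and walk-in, as functions of the arrival times
`x` of the walk-in customers. -/
def arrivalTime : Fin M ⊕ Fin m → (Fin m → ℝ) → ℝ :=
  Sum.elim (fun i _ => S.time i) (fun i x => x i)

lemma measurable_arrivalTime (i : Fin M ⊕ Fin m) : Measurable (arrivalTime S i) := by
  cases i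
  · exact measurable_const
  · exact measurable_pi_apply _

lemma arrivalsBefore_eq_map {x : Fin m → ℝ} {t : ℝ} {l : List (Fin M ⊕ Fin m)} (hn : l.Nodup)
    (hs : l.Pairwise fun i j => arrivalTime S i x ≤ arrivalTime S j x)
    (hm : ∀ i, i ∈ l ↔ arrivalTime S i x < t) :
    arrivalsBefore S x t = l.map fun i => arrivalTime S i x := by
  refine List.Perm.eq_of_pairwise' (Multiset.pairwise_sort _ _) (List.pairwise_map.2 hs) ?_
  rw [← Multiset.coe_eq_coe, arrivalsBefore, Multiset.sort_eq]
  have hl : (l : Multiset (Fin M ⊕ Fin m)) =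
      (Finset.univ.val).filter fun i => arrivalTime S i x < t :=
    (Multiset.Nodup.ext (Multiset.coe_nodup.2 hn) (Finset.univ.nodup.filter _)).2 fun i => by
      simp [hm]
  have hu : Finset.univ.val.map S.time + Finset.univ.val.map x =
      (Finset.univ : Finset (Fin M ⊕ Fin m)).val.map fun i => arrivalTime S i x := by
    rw [← Finset.univ_disjSum_univ, Finset.val_disjSum, Multiset.disjSum, Multiset.map_add,
      Multiset.map_map, Multiset.map_map]
    rfl
  rw [← Multiset.map_coe, hl, hu, Multiset.filter_map]
  rfl

lemma exists_arrivalsBefore_eq_map (x : Fin m → ℝ) (t : ℝ) :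
    ∃ l : List (Fin M ⊕ Fin m), l.Nodup ∧
      (l.Pairwise fun i j => arrivalTime S i x ≤ arrivalTime S j x) ∧
      ∀ i, i ∈ l ↔ arrivalTime S i x < t := by
  classical
  let r : Fin M ⊕ Fin m → Fin M ⊕ Fin m → Prop := fun i j => arrivalTime S i x ≤ arrivalTime S j x
  have : Std.Total r := ⟨fun i j => le_total _ _⟩
  have : IsTrans _ r := ⟨fun i j k => le_trans⟩
  refine ⟨(Finset.univ.filter fun i => arrivalTime S i x < t).toList.insertionSort r, ?_,
    List.pairwise_insertionSort r _, fun i => by simp⟩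
  exact (List.perm_insertionSort r _).nodup_iff.2 (Finset.nodup_toList _)

lemma measurable_tiesAt (t : ℝ) : Measurable fun x : Fin m → ℝ => tiesAt x t := by
  simp only [tiesAt, Finset.card_filter]
  refine Finset.measurable_fun_sum _ fun i _ => Measurable.ite ?_ measurable_const measurable_const
  exact measurableSet_eq_fun (measurable_pi_apply i) measurable_const

/-- There are countably many orders in which the customers can arrive before `t`; for each of them
the conditional waiting time is given by a measurable expression. -/
lemma measurable_condWait (μ t : ℝ) : Measurable fun x : Fin m → ℝ => condWait μ S x t := by
  let A : List (Fin M ⊕ Fin m) → Set (Fin m → ℝ) := fun l =>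
    {x | l.Nodup ∧ (l.Pairwise fun i j => arrivalTime S i x ≤ arrivalTime S j x) ∧
      ∀ i, i ∈ l ↔ arrivalTime S i x < t}
  let g : List (Fin M ⊕ Fin m) → (Fin m → ℝ) → ℝ := fun l x =>
    ∑ n ∈ Finset.range (l.length + 1),
      trans μ t (l.map fun i => arrivalTime S i x) 0 0 n * tieWait μ S t (tiesAt x t) n
  have hA : ∀ l, MeasurableSet (A l) := fun l => by
    refine ((MeasurableSet.const _).inter (MeasurableSet.inter
      (s₁ := {x | l.Pairwise fun i j => arrivalTime S i x ≤ arrivalTime S j x})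
      (s₂ := {x | ∀ i, i ∈ l ↔ arrivalTime S i x < t}) ?_ ?_))
    · simp only [List.pairwise_iff_get, Set.ofPred_forall]
      exact MeasurableSet.iInter fun i => MeasurableSet.iInter fun j => MeasurableSet.iInter
        fun _ => measurableSet_le (measurable_arrivalTime S _) (measurable_arrivalTime S _)
    · simp only [Set.ofPred_forall]
      refine MeasurableSet.iInter fun i => ?_
      have h := measurableSet_lt (measurable_arrivalTime S i) (measurable_const (a := t))
      by_cases hi : i ∈ l
      · simpa only [hi, true_iff] using h
      · simp only [hi, false_iff]
        exact h.compl
  have hg : ∀ l, Measurable (g l) := fun l =>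
    Finset.measurable_fun_sum _ fun n _ =>
      (measurable_trans μ t (measurable_arrivalTime S) l measurable_const 0 n).mul
        ((measurable_of_countable fun k => tieWait μ S t k n).comp (measurable_tiesAt t))
  have hfg : ∀ l, ∀ x ∈ A l, condWait μ S x t = g l x := fun l x ⟨h1, h2, h3⟩ => by
    rw [condWait_eq, arrivalsBefore_eq_map S h1 h2 h3, List.length_map]
  intro B hB
  have : (fun x : Fin m → ℝ => condWait μ S x t) ⁻¹' B = ⋃ l, A l ∩ g l ⁻¹' B := by
    ext x
    simp only [mem_preimage, mem_iUnion, mem_inter_iff]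
    constructor
    · intro hx
      obtain ⟨l, hl⟩ := exists_arrivalsBefore_eq_map S x t
      exact ⟨l, hl, hfg l x hl ▸ hx⟩
    · rintro ⟨l, hl, hx⟩
      exact (hfg l x hl).symm ▸ hx
  rw [this]
  exact MeasurableSet.iUnion fun l => (hA l).inter (hg l hB)

end Measurability

/-! ### The expected waiting time -/

section Expected

variable {T : ℝ} {M : ℕ} (S : Schedule T M) {μ lam t : ℝ} {F : Measure ℝ}

lemma expectedWait_eq : expectedWait μ lam S F t = ∑' m : ℕ, ENNReal.ofReal (pois 1 lam m) *
    ∫⁻ x : Fin m → ℝ, ENNReal.ofReal (condWait μ S x t) ∂(Measure.pi fun _ => F) := by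
  simp only [expectedWait, pois, one_mul]

lemma ae_pi_of_ae [SigmaFinite F] {p : ℝ → Prop} (h : ∀ᵐ a ∂F, p a) (m : ℕ) :
    ∀ᵐ x ∂(Measure.pi fun _ : Fin m => F), ∀ i, p (x i) :=
  ae_all_iff.2 fun _ => Measure.tendsto_eval_ae_ae.eventually h

lemma tsum_ofReal_pois (lam : ℝ) (hlam : 0 ≤ lam) :
    ∑' m, ENNReal.ofReal (pois 1 lam m) = 1 := by
  rw [← ENNReal.ofReal_tsum_of_nonneg (fun m => pois_nonneg zero_le_one hlam m)
    (hasSum_pois 1 lam).summable, (hasSum_pois 1 lam).tsum_eq, ENNReal.ofReal_one]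

/-- The mean of an affine function of a Poisson variable. -/
lemma tsum_ofReal_pois_mul (hlam : 0 ≤ lam) {a b : ℝ} (ha : 0 ≤ a) (hb : 0 ≤ b) :
    ∑' m : ℕ, ENNReal.ofReal (pois 1 lam m) * ENNReal.ofReal (a + b * m) =
      ENNReal.ofReal (a + b * lam) := by
  have hp := fun m => pois_nonneg zero_le_one hlam m
  have h : HasSum (fun m : ℕ => pois 1 lam m * (a + b * m)) (a + b * lam) := by
    have h := ((hasSum_pois 1 lam).mul_left a).add ((hasSum_mul_pois 1 lam).mul_left b)
    rw [mul_one, one_mul] at h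
    exact h.congr_fun fun m => by ring
  simp only [← ENNReal.ofReal_mul (hp _)]
  rw [← ENNReal.ofReal_tsum_of_nonneg (fun m => mul_nonneg (hp m) (by positivity)) h.summable,
    h.tsum_eq]

lemma lintegral_condWait_le [IsProbabilityMeasure F] (hF : ∀ᵐ a ∂F, 0 ≤ a) (hμ : 0 < μ)
    (ht : 0 ≤ t) (m : ℕ) :
    ∫⁻ x : Fin m → ℝ, ENNReal.ofReal (condWait μ S x t) ∂(Measure.pi fun _ => F) ≤
      ENNReal.ofReal (3 * M / μ + 2 / μ * m) := by
  calc _ ≤ ∫⁻ x : Fin m → ℝ, ENNReal.ofReal (3 * M / μ + 2 / μ * m) ∂(Measure.pi fun _ => F) := by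
        refine lintegral_mono_ae ?_
        filter_upwards [ae_pi_of_ae hF m] with x hx
        refine ENNReal.ofReal_le_ofReal ((condWait_le' S hμ ht hx).trans_eq ?_)
        ring
    _ = _ := by simp

/-- The expected waiting time has a left limit, obtained by taking the limit for each arrangement
of the arrival times. -/
lemma tendsto_expectedWait [IsProbabilityMeasure F] (hF : ∀ᵐ a ∂F, 0 ≤ a) (hμ : 0 < μ)
    (hlam : 0 ≤ lam) (ht : 0 < t) :
    Tendsto (fun s => expectedWait μ lam S F s) (𝓝[<] t)
      (𝓝 (∑' m : ℕ, ENNReal.ofReal (pois 1 lam m) *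
        ∫⁻ x : Fin m → ℝ, ENNReal.ofReal (leftCondWait μ S x t) ∂(Measure.pi fun _ => F))) := by
  have hpos : ∀ᶠ s in 𝓝[<] t, 0 ≤ s := by
    filter_upwards [Ioo_mem_nhdsLT ht] with s hs using hs.1.le
  simp only [expectedWait_eq, ← lintegral_count]
  refine tendsto_lintegral_filter_of_dominated_convergence
    (fun m : ℕ => ENNReal.ofReal (pois 1 lam m) * ENNReal.ofReal (3 * M / μ + 2 / μ * m))
    (Eventually.of_forall fun s => measurable_of_countable _) ?_ ?_
    (Eventually.of_forall fun m => ?_)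
  · filter_upwards [hpos] with s hs
    exact Eventually.of_forall fun m => mul_le_mul_right (lintegral_condWait_le S hF hμ hs m) _
  · rw [lintegral_count, tsum_ofReal_pois_mul hlam (by positivity) (by positivity)]
    exact ENNReal.ofReal_ne_top
  · refine ENNReal.Tendsto.const_mul ?_ (Or.inr ENNReal.ofReal_ne_top)
    refine tendsto_lintegral_filter_of_dominated_convergence
      (fun _ => ENNReal.ofReal ((3 * M + 2 * m) / μ))
      (Eventually.of_forall fun s => (measurable_condWait S μ s).ennreal_ofReal) ?_ (by simp)
      (Eventually.of_forall fun x => ENNReal.tendsto_ofReal (tendsto_condWait S hμ x t))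
    filter_upwards [hpos] with s hs
    filter_upwards [ae_pi_of_ae hF m] with x hx
    exact ENNReal.ofReal_le_ofReal (condWait_le' S hμ hs hx)

/-- If `t` is an atom then, with positive probability, exactly one other walk-in customer arrives,
and she arrives at `t`; it is then strictly better to arrive just before `t`. -/
lemma tsum_leftCondWait_lt [IsProbabilityMeasure F] (hF : ∀ᵐ a ∂F, 0 ≤ a) (hμ : 0 < μ)
    (hlam : 0 < lam) (ht : 0 ≤ t) (hatom : F {t} ≠ 0) :
    ∑' m : ℕ, ENNReal.ofReal (pois 1 lam m) *
        ∫⁻ x : Fin m → ℝ, ENNReal.ofReal (leftCondWait μ S x t) ∂(Measure.pi fun _ => F) <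
      expectedWait μ lam S F t := by
  have hle : ∀ m : ℕ, (fun x : Fin m → ℝ => ENNReal.ofReal (leftCondWait μ S x t)) ≤ᵐ[
      Measure.pi fun _ => F] fun x => ENNReal.ofReal (condWait μ S x t) := fun m => by
    filter_upwards [ae_pi_of_ae hF m] with x hx
    exact ENNReal.ofReal_le_ofReal (leftCondWait_le S hμ ht hx)
  have hbound : ∀ m : ℕ, ∫⁻ x : Fin m → ℝ, ENNReal.ofReal (leftCondWait μ S x t)
      ∂(Measure.pi fun _ => F) ≤ ENNReal.ofReal (3 * M / μ + 2 / μ * m) := fun m =>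
    (lintegral_mono_ae (hle m)).trans (lintegral_condWait_le S hF hμ ht m)
  rw [expectedWait_eq]
  refine ENNReal.tsum_lt_tsum (i := 1) (ne_top_of_le_ne_top ?_
    (ENNReal.tsum_le_tsum fun m => mul_le_mul_right (hbound m) _))
    (fun m => mul_le_mul_right (lintegral_mono_ae (hle m)) _) ?_
  · rw [tsum_ofReal_pois_mul hlam.le (by positivity) (by positivity)]
    exact ENNReal.ofReal_ne_top
  · refine ENNReal.mul_lt_mul_right ?_ ENNReal.ofReal_ne_top ?_
    · simp only [pois, ne_eq, ENNReal.ofReal_eq_zero, not_le]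
      positivity
    refine lintegral_strict_mono_of_ae_le_of_ae_lt_on
      (measurable_condWait S μ t).ennreal_ofReal.aemeasurable
      (ne_top_of_le_ne_top ENNReal.ofReal_ne_top (hbound 1)) (hle 1)
      (s := Set.pi univ fun _ => {t}) ?_ ?_
    · rw [Measure.pi_pi]
      simpa using hatom
    · filter_upwards [ae_pi_of_ae hF 1] with x hx hxt
      have hlt : leftCondWait μ S x t < condWait μ S x t := by
        refine leftCondWait_lt S hμ ht hx (Finset.card_ne_zero.2 ⟨0, ?_⟩)
        simpa using hxt 0 (mem_univ 0)
      exact (ENNReal.ofReal_lt_ofReal_iff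
        ((leftCondWait_nonneg S hμ ht hx).trans_lt hlt)).2 hlt

/-- If others arrive before `t` with positive probability, the expected waiting time is positive. -/
lemma expectedWait_ne_zero [IsProbabilityMeasure F] (hF : ∀ᵐ a ∂F, 0 ≤ a) (hμ : 0 < μ)
    (hlam : 0 < lam) (ht : 0 ≤ t) (h : F (Iio t) ≠ 0) : expectedWait μ lam S F t ≠ 0 := by
  rw [expectedWait_eq]
  intro h0
  have h1 := (mul_eq_zero.1 (ENNReal.tsum_eq_zero.1 h0 1)).resolve_left (by
    simp only [pois, ENNReal.ofReal_eq_zero, not_le]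
    positivity)
  rw [lintegral_eq_zero_iff (measurable_condWait S μ t).ennreal_ofReal] at h1
  have h2 : (Measure.pi fun _ : Fin 1 => F) (Set.pi univ fun _ => Iio t) = 0 := by
    refine measure_eq_zero_iff_ae_notMem.2 ?_
    filter_upwards [h1, ae_pi_of_ae hF 1] with x hx0 hx hxt
    refine (condWait_pos S hμ ht hx fun hnil => ?_).not_ge (ENNReal.ofReal_eq_zero.1 hx0)
    have : x 0 ∈ arrivalsBefore S x t :=
      (mem_arrivalsBefore S).2 ⟨Or.inr ⟨0, rfl⟩, hxt 0 (mem_univ 0)⟩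
    simp [hnil] at this
  rw [Measure.pi_pi] at h2
  exact h (by simpa using h2)

/-- If nobody else arrives at time `0`, a customer arriving at time `0` does not wait. -/
lemma expectedWait_zero_of_no_atom [IsProbabilityMeasure F] (hF : ∀ᵐ a ∂F, 0 ≤ a)
    (hS : ∀ i, 0 < S.time i) (h : F {0} = 0) : expectedWait μ lam S F 0 = 0 := by
  have hF' : ∀ᵐ a ∂F, 0 < a := by
    filter_upwards [hF, measure_eq_zero_iff_ae_notMem.1 h] with a h1 h2
    exact lt_of_le_of_ne h1 (Ne.symm h2)
  rw [expectedWait_eq, ENNReal.tsum_eq_zero]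
  refine fun m => mul_eq_zero_of_right _ ?_
  rw [lintegral_congr_ae (g := fun _ => 0), lintegral_zero]
  filter_upwards [ae_pi_of_ae hF' m] with x hx
  have harr : arrivalsBefore S x 0 = [] := List.eq_nil_iff_forall_not_mem.2 fun a ha => by
    rcases (mem_arrivalsBefore S).1 ha with ⟨⟨i, rfl⟩ | ⟨i, rfl⟩, ha⟩
    exacts [lt_asymm (hS i) ha, lt_asymm (hx i) ha]
  have hcount : S.countAt 0 = 0 :=
    Finset.card_eq_zero.2 (Finset.filter_eq_empty_iff.2 fun i _ => (hS i).ne')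
  have hties : tiesAt x 0 = 0 :=
    Finset.card_eq_zero.2 (Finset.filter_eq_empty_iff.2 fun i _ => (hx i).ne')
  rw [condWait_of_arrivalsBefore_eq_nil S harr, hties, tieWait_zero, hcount, wait_zero,
    ENNReal.ofReal_zero]

/-- A probability measure on the line without atoms charges the past of some typical point. -/
lemma exists_measure_Iio_ne_zero [IsProbabilityMeasure F] (hF : ∀ t, F {t} = 0) {p : ℝ → Prop}
    (hp : ∀ᵐ t ∂F, p t) : ∃ t, p t ∧ F (Iio t) ≠ 0 := by
  by_contra! hcon
  -- Up to one point, the set of `t` with a null past is a union of open null sets.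
  have hnull : F (⋃ t ∈ {t | p t}, Iio t) = 0 := by
    obtain ⟨c, hc, hcc, hU⟩ := TopologicalSpace.isOpen_biUnion_countable {t | p t} Iio
      (fun t _ => isOpen_Iio)
    rw [← hU]
    exact (measure_biUnion_null_iff hcc).2 fun t ht => hcon t (hc ht)
  have hsub : ({t | p t} \ ⋃ t ∈ {t | p t}, Iio t).Subsingleton := by
    rintro a ⟨ha, ha'⟩ b ⟨hb, hb'⟩
    simp only [mem_iUnion, not_exists, mem_Iio, not_lt] at ha' hb'
    exact le_antisymm (hb' a ha) (ha' b hb)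
  have hrest : F ({t | p t} \ ⋃ t ∈ {t | p t}, Iio t) = 0 := by
    rcases hsub.eq_empty_or_singleton with h | ⟨a, h⟩ <;> rw [h]
    exacts [measure_empty, hF a]
  have hfalse : ∀ᵐ t ∂F, False := by
    filter_upwards [hp, measure_eq_zero_iff_ae_notMem.1 hnull,
      measure_eq_zero_iff_ae_notMem.1 hrest] with t h1 h2 h3
    exact h3 ⟨h1, h2⟩
  exact (IsProbabilityMeasure.ne_zero F) (ae_eq_bot.1 (eventually_false_iff_eq_bot.1 hfalse))

/-! ### Atoms of equilibria -/

lemma IsEquilibrium.ae_nonneg (h : IsEquilibrium μ lam S F) : ∀ᵐ a ∂F, 0 ≤ a := by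
  filter_upwards [measure_eq_zero_iff_ae_notMem.1 h.support] with a ha
  exact (not_not.1 ha).1

lemma IsEquilibrium.not_hasAtom (h : IsEquilibrium μ lam S F) (hμ : 0 < μ) (hlam : 0 < lam)
    (ht : t ∈ Ioc 0 T) : ¬ HasAtom F t := by
  intro hatom
  have := h.isProbabilityMeasure
  obtain ⟨c, hc, hae⟩ := h.exists_value
  have hct : expectedWait μ lam S F t = c := by
    by_contra hne
    exact hatom.ne' (measure_mono_null (singleton_subset_iff.2 hne) (ae_iff.1 hae))
  have hlt := tsum_leftCondWait_lt S h.ae_nonneg hμ hlam ht.1.le hatom.ne'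
  rw [hct] at hlt
  refine hlt.not_ge (ge_of_tendsto (tendsto_expectedWait S h.ae_nonneg hμ hlam.le ht.1) ?_)
  filter_upwards [Ioo_mem_nhdsLT ht.1] with s hs
  exact hc s ⟨hs.1.le, hs.2.le.trans ht.2⟩

lemma IsEquilibrium.hasAtom_zero (h : IsEquilibrium μ lam S F) (hT : 0 ≤ T) (hμ : 0 < μ)
    (hlam : 0 < lam) (hS : ∀ i, 0 < S.time i) : HasAtom F 0 := by
  refine pos_iff_ne_zero.2 fun h0 => ?_
  have := h.isProbabilityMeasure
  have hno : ∀ t, F {t} = 0 := fun t => by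
    by_cases ht : t ∈ Icc 0 T
    · rcases ht.1.eq_or_lt with rfl | ht0
      · exact h0
      · exact not_not.1 fun hne => h.not_hasAtom S hμ hlam ⟨ht0, ht.2⟩ (pos_iff_ne_zero.2 hne)
    · exact measure_mono_null (singleton_subset_iff.2 ht) h.support
  obtain ⟨c, hc, hae⟩ := h.exists_value
  have hc0 : (c : ℝ≥0∞) = 0 := le_antisymm
    ((hc 0 ⟨le_rfl, hT⟩).trans_eq (expectedWait_zero_of_no_atom S h.ae_nonneg hS h0)) zero_le
  obtain ⟨t, ⟨hwt, ht⟩, hpast⟩ := exists_measure_Iio_ne_zero hno (hae.and h.ae_nonneg)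
  exact expectedWait_ne_zero S h.ae_nonneg hμ hlam ht hpast (hwt.trans hc0)

lemma ae_pi_dirac_zero (m : ℕ) :
    ∀ᵐ x ∂(Measure.pi fun _ : Fin m => Measure.dirac (0 : ℝ)), x = 0 := by
  have h : ∀ᵐ a ∂(Measure.dirac (0 : ℝ)), a = 0 := by simp [ae_dirac_eq]
  filter_upwards [ae_pi_of_ae h m] with x hx using funext hx

lemma expectedWait_dirac_zero : expectedWait μ lam S (Measure.dirac 0) t =
    ∑' m : ℕ, ENNReal.ofReal (pois 1 lam m) *
      ENNReal.ofReal (condWait μ S (0 : Fin m → ℝ) t) := by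
  rw [expectedWait_eq]
  refine tsum_congr fun m => ?_
  rw [lintegral_congr_ae (g := fun _ => ENNReal.ofReal (condWait μ S (0 : Fin m → ℝ) t))]
  · simp
  · filter_upwards [ae_pi_dirac_zero m] with x hx
    rw [hx]

lemma expectedWait_dirac_zero_le (hμ : 0 < μ) (hlam : 0 ≤ lam) :
    expectedWait μ lam S (Measure.dirac 0) 0 ≤
      ENNReal.ofReal (2 * M / μ + 1 / (2 * μ) * lam) := by
  rw [expectedWait_dirac_zero, ← tsum_ofReal_pois_mul hlam (by positivity) (by positivity)]
  refine ENNReal.tsum_le_tsum fun m => mul_le_mul_right (ENNReal.ofReal_le_ofReal ?_) _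
  have harr : arrivalsBefore S (0 : Fin m → ℝ) 0 = [] :=
    List.eq_nil_iff_forall_not_mem.2 fun a ha => by
      rcases (mem_arrivalsBefore S).1 ha with ⟨⟨i, rfl⟩ | ⟨i, rfl⟩, ha⟩
      exacts [(S.mem_Icc i).1.not_gt ha, lt_irrefl _ ha]
  have hk : (tiesAt (0 : Fin m → ℝ) 0 : ℝ) ≤ m := by exact_mod_cast tiesAt_le
  rw [condWait_of_arrivalsBefore_eq_nil S harr]
  refine (tieWait_le S hμ 0 _ 0).trans ?_
  calc ((0 : ℕ) + 2 * (M : ℝ) + tiesAt (0 : Fin m → ℝ) 0 / 2) / μ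
      ≤ (2 * M + m / 2) / μ := by
        refine div_le_div_of_nonneg_right ?_ hμ.le
        push_cast
        linarith
    _ = 2 * M / μ + 1 / (2 * μ) * m := by ring

lemma le_expectedWait_dirac_zero_add (hμ : 0 < μ) (hlam : 0 ≤ lam) (ht : 0 < t) :
    ENNReal.ofReal (1 / μ * lam) ≤
      expectedWait μ lam S (Measure.dirac 0) t + ENNReal.ofReal t := by
  calc ENNReal.ofReal (1 / μ * lam)
      = ∑' m : ℕ, ENNReal.ofReal (pois 1 lam m) * ENNReal.ofReal (0 + 1 / μ * m) := by
        rw [tsum_ofReal_pois_mul hlam le_rfl (by positivity), zero_add]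
    _ ≤ ∑' m : ℕ, (ENNReal.ofReal (pois 1 lam m) *
          ENNReal.ofReal (condWait μ S (0 : Fin m → ℝ) t) +
          ENNReal.ofReal (pois 1 lam m) * ENNReal.ofReal t) := by
        refine ENNReal.tsum_le_tsum fun m => ?_
        have hx : ∀ i, 0 ≤ (0 : Fin m → ℝ) i := fun _ => le_rfl
        rw [← mul_add, ← ENNReal.ofReal_add (condWait_nonneg S hμ ht.le hx) ht.le]
        refine mul_le_mul_right (ENNReal.ofReal_le_ofReal ?_) _
        have h1 := le_condWait S hμ ht.le hx
        have h2 : (m : ℝ) / μ ≤ (arrivalsBefore S (0 : Fin m → ℝ) t).length / μ := by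
          have := le_length_arrivalsBefore S (x := (0 : Fin m → ℝ)) fun _ => ht
          gcongr
        have h3 : 0 + 1 / μ * (m : ℝ) = m / μ := by ring
        linarith
    _ = expectedWait μ lam S (Measure.dirac 0) t + ENNReal.ofReal t := by
        rw [ENNReal.tsum_add, ENNReal.tsum_mul_right, tsum_ofReal_pois lam hlam, one_mul,
          expectedWait_dirac_zero]

/-- If many walk-in customers are expected it is an equilibrium that all of them arrive at time
`0`: a customer who arrives at time `0` is behind half of the others on average, one who arrives
later is behind all of those who are not served yet. -/
lemma isEquilibrium_dirac_zero (hT : 0 ≤ T) (hμ : 0 < μ) (hlam : 4 * M + 2 * (μ * T) ≤ lam) :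
    IsEquilibrium μ lam S (Measure.dirac 0) := by
  have hlam0 : 0 ≤ lam := le_trans (by positivity) hlam
  have h0 := expectedWait_dirac_zero_le S hμ hlam0
  have h0top := ne_top_of_le_ne_top ENNReal.ofReal_ne_top h0
  refine ⟨inferInstance, by simp [hT], (expectedWait μ lam S (Measure.dirac 0) 0).toNNReal, ?_, ?_⟩
  · intro t ht
    rw [ENNReal.coe_toNNReal h0top]
    rcases ht.1.eq_or_lt with rfl | ht0
    · exact le_rfl
    refine (ENNReal.add_le_add_iff_right (ENNReal.ofReal_ne_top (r := t))).1
      (le_trans ?_ (le_expectedWait_dirac_zero_add S hμ hlam0 ht0))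
    calc _ ≤ ENNReal.ofReal (2 * M / μ + 1 / (2 * μ) * lam) + ENNReal.ofReal T :=
          add_le_add h0 (ENNReal.ofReal_le_ofReal ht.2)
      _ = ENNReal.ofReal (2 * M / μ + 1 / (2 * μ) * lam + T) :=
          (ENNReal.ofReal_add (by positivity) hT).symm
      _ ≤ _ := by
          refine ENNReal.ofReal_le_ofReal ?_
          have : 2 * M / μ + 1 / (2 * μ) * lam + T
              = 1 / μ * lam - (lam - (4 * M + 2 * (μ * T))) / (2 * μ) := by
            field_simp
            ring
          rw [this]
          exact sub_le_self _ (div_nonneg (sub_nonneg.2 hlam) (by positivity))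
  · rw [ae_dirac_eq, ENNReal.coe_toNNReal h0top]
    exact rfl

lemma Schedule.time_pos_of_aug_one_pos (h : 0 < S.aug 1) (i : Fin M) : 0 < S.time i := by
  have hM : 0 < M := i.pos
  rw [Schedule.aug, if_neg one_ne_zero, dif_pos hM] at h
  exact h.trans_le (S.strictMono.monotone (Nat.zero_le _))

end Expected

end WalkIn

end

theorem proposition1 (T μ : ℝ) (hT : 0 < T) (hμ : 0 < μ) (M : ℕ) (S : WalkIn.Schedule T M) :
    (∀ (lam : ℝ) (F : Measure ℝ), 0 < lam → WalkIn.IsEquilibrium μ lam S F →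
      ∀ t ∈ Ioc 0 T, ¬ WalkIn.HasAtom F t) ∧
    (0 < S.aug 1 → ∀ (lam : ℝ) (F : Measure ℝ), 0 < lam → WalkIn.IsEquilibrium μ lam S F →
      WalkIn.HasAtom F 0) ∧
    (S.aug 1 = 0 → ∃ (lam : ℝ) (F : Measure ℝ), 0 < lam ∧ WalkIn.IsEquilibrium μ lam S F ∧
      WalkIn.HasAtom F 0) := by
  refine ⟨fun lam F hlam h t ht => h.not_hasAtom S hμ hlam ht, fun hS lam F hlam h =>
    h.hasAtom_zero S hT.le hμ hlam (S.time_pos_of_aug_one_pos hS), fun _ => ?_⟩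
  refine ⟨4 * M + 2 * (μ * T), Measure.dirac 0, by positivity,
    WalkIn.isEquilibrium_dirac_zero S hT.le hμ le_rfl, ?_⟩
  simp [WalkIn.HasAtom]
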